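/- Let $\kappa\ge 1$ be an integer, let $k\in\{4,6,8,\ldots\}$, and let $\psi\colon\mathbb R\to(0,\infty)$ be a continuous even function that extends to an entire function of the form $\Phi(z)=\alpha_0+\sum_{n=k}^{\infty}\alpha_n z^n$ ($z\in\mathbb C$) with $\alpha_0\ge 0$, $\alpha_k>0$ and $\alpha_n\ge 0$ for all $n\ge k+1$. Suppose that $\limsup_{x\to\infty}\psi'(x)/\psi(x)<\infty$. Let $\mu_\rho$ be the Borel measure on $\mathbb R^\kappa$ given by $d\mu_\rho(x)=\rho(x)\,dx$, where $\rho(x)=\psi(\|x\|)^{-1}$ and $\|\cdot\|$ is the Euclidean norm, and for $a\in\mathbb R^\kappa$ let $C_{I+a,\rho}$ be the composition operator $f\mapsto f(\cdot+a)$ on the complex Hilbert space $L^2(\mu_\rho)$. Then, for every $a\in\mathbb R^\kappa$, $C_{I+a,\rho}$ is a well-defined bounded linear operator on all of $L^2(\mu_\rho)$, and there exists $\varepsilon\in(0,\infty)$ such that for every $a\in\mathbb R^\kappa$ with $0<\|a\|<\varepsilon$ the operator $C_{I+a,\rho}$ is not cosubnormal. Here a bounded operator $S$ on a complex Hilbert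 space $H$ is called cosubnormal if its adjoint $S^*$ is subnormal, i.e. if there are a complex Hilbert space $K$ containing $H$ isometrically and a bounded normal operator $N$ on $K$ such that $S^*h=Nh$ for every $h\in H$. -/

import Mathlib

open MeasureTheory Filter

/-- For `k ≥ 1`, the class `𝓗_k` of entire functions `Φ(z) = α₀ + ∑_{n ≥ k} αₙ zⁿ` with
all coefficients real and nonnegative, and `α_k > 0`. -/
def entireClass (k : ℕ) : Set (ℂ → ℂ) :=
  {Φ | ∃ α : ℕ → ℝ, (∀ n, 0 ≤ α n) ∧ (∀ n, 0 < n → n < k → α n = 0) ∧ 0 < α k ∧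
    ∀ z : ℂ, HasSum (fun n : ℕ => (α n : ℂ) * z ^ n) (Φ z)}

/-- A function `ψ` on the real line is said to belong to `𝓗_k` if it extends to an entire
function in `𝓗_k`. -/
def MemEntireClass (k : ℕ) (ψ : ℝ → ℝ) : Prop :=
  ∃ Φ ∈ entireClass k, ∀ x : ℝ, Φ (x : ℂ) = (ψ x : ℂ)

/-- The radial density `ρ(x) = ψ(‖x‖)⁻¹` on `ℝ^κ`. -/
noncomputable def radialDensity (κ : ℕ) (ψ : ℝ → ℝ) (x : EuclideanSpace ℝ (Fin κ)) : ℝ :=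
  (ψ ‖x‖)⁻¹

/-- The measure `dμ_ρ = ρ dV_κ` on `ℝ^κ`, where `V_κ` is the Lebesgue measure. -/
noncomputable def densityMeasure (κ : ℕ) (ρ : EuclideanSpace ℝ (Fin κ) → ℝ) :
    Measure (EuclideanSpace ℝ (Fin κ)) :=
  volume.withDensity fun x => ENNReal.ofReal (ρ x)

/-- The bounded operator `C` on the complex space `L²(μ)` is the composition operator with
symbol `T`: for every square integrable `f`, `C f = f ∘ T` as elements of `L²(μ)`. Since `f`
runs over functions and not over classes, this includes that `f ∘ T` is in `L²(μ)` and that its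
class depends only on the class of `f`. -/
def IsCompositionOperator {X : Type*} [MeasurableSpace X] (μ : Measure X) (T : X → X)
    (C : Lp ℂ 2 μ →L[ℂ] Lp ℂ 2 μ) : Prop :=
  ∀ (f : X → ℂ) (hf : MemLp f 2 μ), C (hf.toLp f) =ᵐ[μ] f ∘ T

/-- A bounded operator on a complex Hilbert space `H` is subnormal if it is the restriction of
a bounded normal operator on a complex Hilbert space `K` in which `H` is isometrically
embedded. -/
def IsSubnormalOperator.{u} {H : Type u} [NormedAddCommGroup H] [InnerProductSpace ℂ H]
    (S : H →L[ℂ] H) : Prop :=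
  ∃ (K : Type u) (_ : NormedAddCommGroup K) (_ : InnerProductSpace ℂ K) (_ : CompleteSpace K)
    (J : H →ₗᵢ[ℂ] K) (N : K →L[ℂ] K), IsStarNormal N ∧ ∀ h : H, N (J h) = J (S h)

/-- A bounded operator on a complex Hilbert space is cosubnormal if its adjoint is subnormal. -/
def IsCosubnormalOperator.{u} {H : Type u} [NormedAddCommGroup H] [InnerProductSpace ℂ H]
    [CompleteSpace H] (S : H →L[ℂ] H) : Prop :=
  IsSubnormalOperator (ContinuousLinearMap.adjoint S)

open scoped Topology InnerProductSpace

/-! If `S` is subnormal, the moments `‖S ^ n h‖ ^ 2` form a positive semidefinite Hankel matrix for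
each `h`. The adjoint of the composition operator carries the Riesz representative of integration
over a ball to that of the translated ball (`adjoint_apply_ballWeight`). On a small ball around `p`
its moments are thus averages of `ψ ‖x‖` for `x` near `p + n • a`.

With `p = -a` and `r = ‖a‖` the centre values are `ψ ((n - 1) * r)`, which is `α₀ + α_k ((n - 1) r)
^ k + o(r ^ k)`. A real vector with sum zero removes `α₀`, and `hankelTestVector` makes the `k`-th
power form strictly negative, so positivity fails for all small `r`. Boundedness comes from the
growth condition on `ψ` (`exists_shift_bound`). -/

/-! ### Hankel positivity for subnormal operators -/

/-- For a normal extension `N`, the form equals `‖∑ c i • N*^i N^i J h‖ ^ 2`, because `N` and `N*`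
commute. -/
theorem IsSubnormalOperator.hankel_nonneg {H : Type*} [NormedAddCommGroup H]
    [InnerProductSpace ℂ H] {S : H →L[ℂ] H} (hS : IsSubnormalOperator S) (h : H) {n : ℕ}
    (c : Fin n → ℝ) :
    0 ≤ ∑ i, ∑ j, c i * c j * ‖(S ^ (i + j : ℕ)) h‖ ^ 2 := by
  obtain ⟨K, _, _, _, J, N, hN, hJ⟩ := hS
  have hpow : ∀ m : ℕ, (N ^ m) (J h) = J ((S ^ m) h) := by
    intro m
    induction m with
    | zero => simp
    | succ m ih => rw [pow_succ', pow_succ', mul_apply_eq_comp,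
        mul_apply_eq_comp, ih, hJ]
  have hcomm : ∀ i j : ℕ, Commute (star N ^ i) (N ^ j) := fun i j =>
    (show Commute (star N) N from hN.star_comm_self).pow_pow i j
  have hadj : ∀ (i : ℕ) (x y : K), ⟪(star N ^ i) x, y⟫_ℂ = ⟪x, (N ^ i) y⟫_ℂ := by
    intro i x y
    rw [← star_pow, ContinuousLinearMap.star_eq_adjoint, ContinuousLinearMap.adjoint_inner_left]
  have hadj' : ∀ (i : ℕ) (x y : K), ⟪x, (star N ^ i) y⟫_ℂ = ⟪(N ^ i) x, y⟫_ℂ := by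
    intro i x y
    rw [← inner_conj_symm, hadj, inner_conj_symm]
  set w : K := ∑ i : Fin n, (c i : ℂ) • (star N ^ (i : ℕ)) ((N ^ (i : ℕ)) (J h)) with hw
  have hterm : ∀ i j : ℕ, ⟪(star N ^ i) ((N ^ i) (J h)), (star N ^ j) ((N ^ j) (J h))⟫_ℂ
      = ((‖(S ^ (i + j)) h‖ ^ 2 : ℝ) : ℂ) := by
    intro i j
    have h1 : (N ^ j) ((star N ^ i) ((N ^ i) (J h))) = (star N ^ i) ((N ^ (i + j)) (J h)) := by
      rw [← mul_apply_eq_comp, ← (hcomm i j).eq, mul_apply_eq_comp,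
        ← mul_apply_eq_comp (N ^ j), ← pow_add, add_comm j i]
    rw [hadj', h1, hadj, ← mul_apply_eq_comp, ← pow_add, hpow,
      inner_self_eq_norm_sq_to_K, J.norm_map]
    simp
  have key : ((‖w‖ ^ 2 : ℝ) : ℂ)
      = ((∑ i, ∑ j, c i * c j * ‖(S ^ (i + j : ℕ)) h‖ ^ 2 : ℝ) : ℂ) := by
    have : ((‖w‖ ^ 2 : ℝ) : ℂ) = ⟪w, w⟫_ℂ := by
      rw [inner_self_eq_norm_sq_to_K]; simp
    rw [this, hw, sum_inner]
    simp only [Complex.ofReal_sum, Complex.ofReal_mul (c _ * c _)]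
    refine Finset.sum_congr rfl fun i _ => ?_
    rw [inner_sum]
    refine Finset.sum_congr rfl fun j _ => ?_
    rw [inner_smul_left, inner_smul_right, hterm, Complex.conj_ofReal]
    push_cast
    ring
  have := Complex.ofReal_injective key
  rw [← this]
  positivity

/-! ### Bounded composition operators -/

theorem exists_isCompositionOperator {X : Type*} [MeasurableSpace X] {μ : Measure X} {T : X → X}
    (hT : Measurable T) {c : ENNReal} (hc : c ≠ ⊤) (hμ : μ.map T ≤ c • μ) :
    ∃ C : Lp ℂ 2 μ →L[ℂ] Lp ℂ 2 μ, IsCompositionOperator μ T C := by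
  have hqmp : Measure.QuasiMeasurePreserving T μ μ :=
    ⟨hT, Measure.absolutelyContinuous_of_le_smul hμ⟩
  have hmem : ∀ f : X → ℂ, MemLp f 2 μ → MemLp (f ∘ T) 2 μ := fun f hf =>
    (memLp_map_measure_iff (hf.1.mono_ac hqmp.2) hT.aemeasurable).1
      (hf.of_measure_le_smul hc hμ)
  let L : Lp ℂ 2 μ →ₗ[ℂ] Lp ℂ 2 μ :=
    { toFun := fun f => (hmem f (Lp.memLp f)).toLp _
      map_add' := by
        intro f g
        rw [← MemLp.toLp_add]
        exact MemLp.toLp_congr _ _ (hqmp.ae_eq (Lp.coeFn_add f g))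
      map_smul' := by
        intro r f
        rw [RingHom.id_apply, ← MemLp.toLp_const_smul]
        exact MemLp.toLp_congr _ _ (hqmp.ae_eq (Lp.coeFn_smul r f)) }
  have hbound : ∀ f, ‖L f‖ ≤ (c ^ (1 / (2 : ENNReal)).toReal).toReal * ‖f‖ := by
    intro f
    change ‖(hmem f (Lp.memLp f)).toLp _‖ ≤ _
    rw [Lp.norm_toLp, Lp.norm_def, ← ENNReal.toReal_mul]
    refine ENNReal.toReal_mono
      (ENNReal.mul_ne_top (ENNReal.rpow_ne_top_of_nonneg (by positivity) hc)
        (Lp.eLpNorm_ne_top f)) ?_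
    rw [← eLpNorm_map_measure ((Lp.aestronglyMeasurable f).mono_ac hqmp.2) hT.aemeasurable]
    exact eLpNorm_le_of_measure_le_smul hμ
  refine ⟨L.mkContinuous _ hbound, fun f hf => ?_⟩
  have h1 : (L (hf.toLp f) : X → ℂ) =ᵐ[μ] (hf.toLp f) ∘ T := MemLp.coeFn_toLp (hmem _ (Lp.memLp _))
  exact h1.trans (hqmp.ae_eq hf.coeFn_toLp)

/-! ### Power series and growth of `ψ` -/

theorem exists_hasSum_of_memEntireClass {k : ℕ} {ψ : ℝ → ℝ} (h : MemEntireClass k ψ) :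
    ∃ α : ℕ → ℝ, (∀ n, 0 ≤ α n) ∧ (∀ n, 0 < n → n < k → α n = 0) ∧ 0 < α k ∧
      ∀ x : ℝ, HasSum (fun n => α n * x ^ n) (ψ x) := by
  obtain ⟨Φ, ⟨α, h0, h1, h2, h3⟩, hΦ⟩ := h
  refine ⟨α, h0, h1, h2, fun x => ?_⟩
  have := h3 x
  rw [hΦ] at this
  exact_mod_cast this

theorem hasFPowerSeriesOnBall_ofScalars_of_hasSum {α : ℕ → ℝ} {ψ : ℝ → ℝ}
    (h : ∀ x : ℝ, HasSum (fun n => α n * x ^ n) (ψ x)) :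
    HasFPowerSeriesOnBall ψ (FormalMultilinearSeries.ofScalars ℝ α) 0 ⊤ := by
  refine ⟨?_, by simp, fun {y} _ => ?_⟩
  · refine le_of_eq (Eq.symm (ENNReal.eq_top_of_forall_nnreal_le fun r => ?_))
    refine FormalMultilinearSeries.le_radius_of_summable _ ?_
    have := (h r).summable.norm
    simpa [FormalMultilinearSeries.ofScalars_norm] using this
  · simpa [FormalMultilinearSeries.ofScalars_apply_eq, mul_comm] using h y

theorem monotoneOn_of_hasSum {α : ℕ → ℝ} {ψ : ℝ → ℝ} (hα : ∀ n, 0 ≤ α n)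
    (h : ∀ x : ℝ, HasSum (fun n => α n * x ^ n) (ψ x)) : MonotoneOn ψ (Set.Ici 0) := by
  intro x hx y _ hxy
  refine hasSum_le (fun n => ?_) (h x) (h y)
  exact mul_le_mul_of_nonneg_left (pow_le_pow_left₀ hx hxy n) (hα n)

theorem isLittleO_sub_leading_terms {α : ℕ → ℝ} {ψ : ℝ → ℝ} {k : ℕ} (hk : 0 < k)
    (hα : ∀ n, 0 < n → n < k → α n = 0)
    (h : ∀ x : ℝ, HasSum (fun n => α n * x ^ n) (ψ x)) :
    (fun x => ψ x - α 0 - α k * x ^ k) =o[𝓝 0] fun x => x ^ k := by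
  have h1 := (hasFPowerSeriesOnBall_ofScalars_of_hasSum
    h).hasFPowerSeriesAt.isBigO_sub_partialSum_pow (k + 1)
  have h2 : (fun y : ℝ => ψ (0 + y)
      - (FormalMultilinearSeries.ofScalars ℝ α).partialSum (k + 1) y)
      = fun x => ψ x - α 0 - α k * x ^ k := by
    funext x
    have : ∑ n ∈ Finset.range k, α n * x ^ n = α 0 := by
      rw [Finset.sum_eq_single_of_mem 0 (Finset.mem_range.2 hk)]
      · simp
      · intro n hn hn0
        rw [hα n (Nat.pos_of_ne_zero hn0) (Finset.mem_range.1 hn), zero_mul]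
    simp only [FormalMultilinearSeries.partialSum, FormalMultilinearSeries.ofScalars_apply_eq,
      smul_eq_mul, zero_add, Finset.sum_range_succ, this]
    ring
  rw [h2] at h1
  refine h1.trans_isLittleO ?_
  simp_rw [← norm_pow]
  exact (Asymptotics.isLittleO_norm_left).2 (Asymptotics.isLittleO_pow_pow (Nat.lt_succ_self k))

/-- A Grönwall argument: once `ψ' ≤ M ψ`, the function `ψ x * exp (-M x)` decreases, which bounds
the ratio by `exp (M t)`. Compactness handles the remaining bounded interval. -/
theorem exists_shift_bound {ψ : ℝ → ℝ} (hcont : Continuous ψ) (hpos : ∀ x, 0 < ψ x)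
    (hdiff : Differentiable ℝ ψ)
    (hlim : limsup (fun x : ℝ => ((deriv ψ x / ψ x : ℝ) : EReal)) atTop < ⊤)
    {t : ℝ} (ht : 0 ≤ t) : ∃ c : ℝ, 0 < c ∧ ∀ s, 0 ≤ s → ψ (s + t) ≤ c * ψ s := by
  obtain ⟨M, hM1, -⟩ := EReal.lt_iff_exists_real_btwn.1 hlim
  obtain ⟨X, hX⟩ := eventually_atTop.1 (eventually_lt_of_limsup_lt hM1)
  have hder : ∀ x, X ≤ x → deriv ψ x ≤ M * ψ x := fun x hx =>
    (div_le_iff₀ (hpos x)).1 (EReal.coe_lt_coe_iff.1 (hX x hx)).le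
  have hD : ∀ x, HasDerivAt (fun x => ψ x * Real.exp (-M * x))
      (deriv ψ x * Real.exp (-M * x) + ψ x * (Real.exp (-M * x) * -M)) x := by
    intro x
    have h1 : HasDerivAt (fun x : ℝ => -M * x) (-M) x := by
      simpa using (hasDerivAt_id x).const_mul (-M)
    exact (hdiff x).hasDerivAt.mul h1.exp
  have hanti : AntitoneOn (fun x => ψ x * Real.exp (-M * x)) (Set.Ici X) := by
    refine antitoneOn_of_deriv_nonpos (convex_Ici X)
      (fun x _ => (hD x).continuousAt.continuousWithinAt)
      (fun x _ => (hD x).differentiableAt.differentiableWithinAt) fun x hx => ?_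
    rw [interior_Ici] at hx
    rw [(hD x).deriv]
    nlinarith [Real.exp_pos (-M * x), hder x (le_of_lt hx)]
  have hlarge : ∀ s, X ≤ s → ψ (s + t) ≤ Real.exp (M * t) * ψ s := by
    intro s hs
    have h1 : ψ (s + t) * Real.exp (-M * (s + t)) ≤ ψ s * Real.exp (-M * s) :=
      hanti (Set.mem_Ici.2 hs) (Set.mem_Ici.2 (by linarith)) (by linarith)
    have h2 : Real.exp (-M * s) = Real.exp (M * t) * Real.exp (-M * (s + t)) := by
      rw [← Real.exp_add]; ring_nf
    rw [h2, ← mul_assoc] at h1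
    linarith [le_of_mul_le_mul_right h1 (Real.exp_pos _)]
  obtain ⟨B, hB⟩ := (isCompact_Icc (a := (0 : ℝ)) (b := X)).exists_bound_of_continuousOn
    (f := fun s => ψ (s + t) / ψ s)
    ((hcont.comp (continuous_add_const t)).div hcont fun s => (hpos s).ne').continuousOn
  refine ⟨max (Real.exp (M * t)) B, lt_max_of_lt_left (Real.exp_pos _), fun s hs => ?_⟩
  rcases le_total X s with h | h
  · exact (hlarge s h).trans (mul_le_mul_of_nonneg_right (le_max_left _ _) (hpos s).le)
  · have := (le_abs_self _).trans (hB s ⟨hs, h⟩)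
    exact ((div_le_iff₀ (hpos s)).1 this).trans
      (mul_le_mul_of_nonneg_right (le_max_right _ _) (hpos s).le)

/-! ### The negative Hankel form -/

theorem two_mul_three_pow_lt_four_pow {k : ℕ} (hk : 4 ≤ k) : (2 * 3 ^ k : ℝ) < 4 ^ k := by
  induction k, hk using Nat.le_induction with
  | base => norm_num
  | succ n _ ih =>
    rw [pow_succ, pow_succ]
    nlinarith [pow_pos (show (0 : ℝ) < 3 by norm_num) n]

/-- Coefficients for which the Hankel form of `α₀ + α_k (r (i + j - 1)) ^ k` is negative. -/
noncomputable def hankelTestVector (k : ℕ) : Fin 3 → ℝ := ![2 - 2 ^ k, 2 ^ k, -2]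

theorem sum_hankelTestVector (k : ℕ) : ∑ i, hankelTestVector k i = 0 := by
  simp [hankelTestVector, Fin.sum_univ_three]

/-- Expanding, with `(-1) ^ k = 1`, gives `2 * (2 * 3 ^ k - 4 ^ k) - 4`. For `k = 2` this would be
zero. -/
theorem hankelTestVector_pow_neg {k : ℕ} (hk : 4 ≤ k) (hk_even : Even k) :
    ∑ i : Fin 3, ∑ j : Fin 3, hankelTestVector k i * hankelTestVector k j
      * ((i : ℝ) + j - 1) ^ k < 0 := by
  have h1 := two_mul_three_pow_lt_four_pow hk
  have h2 : (4 : ℝ) ^ k = 2 ^ k * 2 ^ k := by rw [← mul_pow]; norm_num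
  have h0 : k ≠ 0 := by omega
  have hv0 : hankelTestVector k 0 = 2 - 2 ^ k := rfl
  have hv1 : hankelTestVector k 1 = 2 ^ k := rfl
  have hv2 : hankelTestVector k 2 = -2 := rfl
  simp only [hv0, hv1, hv2, Fin.sum_univ_three]
  norm_num [hk_even.neg_pow, h0]
  nlinarith

theorem eventually_hankel_neg {α : ℕ → ℝ} {ψ : ℝ → ℝ} {k : ℕ} (hk : 4 ≤ k) (hk_even : Even k)
    (hα : ∀ n, 0 < n → n < k → α n = 0) (hαk : 0 < α k)
    (h : ∀ x : ℝ, HasSum (fun n => α n * x ^ n) (ψ x)) :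
    ∀ᶠ r in 𝓝[>] (0 : ℝ), ∑ i : Fin 3, ∑ j : Fin 3, hankelTestVector k i * hankelTestVector k j
      * ψ (((i : ℝ) + j - 1) * r) < 0 := by
  set c := hankelTestVector k
  set q := ∑ i : Fin 3, ∑ j : Fin 3, c i * c j * ((i : ℝ) + j - 1) ^ k with hq
  have hq0 : q < 0 := hankelTestVector_pow_neg hk hk_even
  have hψ := isLittleO_sub_leading_terms (by omega) hα h
  have hterm : ∀ m : ℝ, (fun r : ℝ => ψ (m * r) - α 0 - α k * (m * r) ^ k)
      =o[𝓝 0] fun r : ℝ => r ^ k := by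
    intro m
    have ht : Tendsto (fun r : ℝ => m * r) (𝓝 0) (𝓝 0) := by
      simpa using (continuous_const_mul m).tendsto (0 : ℝ)
    refine (hψ.comp_tendsto ht).trans_isBigO ?_
    simp only [Function.comp_def, mul_pow]
    exact Asymptotics.isBigO_const_mul_self _ _ _
  have hsum : (fun r : ℝ => ∑ i : Fin 3, ∑ j : Fin 3,
      c i * c j * (ψ (((i : ℝ) + j - 1) * r) - α 0 - α k * (((i : ℝ) + j - 1) * r) ^ k))
      =o[𝓝 0] fun r : ℝ => r ^ k :=
    Asymptotics.IsLittleO.fun_sum fun i _ => Asymptotics.IsLittleO.fun_sum fun j _ =>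
      (hterm _).const_mul_left _
  have hid : ∀ r : ℝ, ∑ i : Fin 3, ∑ j : Fin 3,
      c i * c j * (ψ (((i : ℝ) + j - 1) * r) - α 0 - α k * (((i : ℝ) + j - 1) * r) ^ k)
      = (∑ i : Fin 3, ∑ j : Fin 3, c i * c j * ψ (((i : ℝ) + j - 1) * r)) - α k * q * r ^ k := by
    intro r
    have h0 : ∑ i : Fin 3, ∑ j : Fin 3, c i * c j * α 0 = 0 := by
      simp_rw [← Finset.sum_mul, ← Finset.mul_sum, ← Finset.sum_mul]
      rw [sum_hankelTestVector]; simp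
    have h1 : ∑ i : Fin 3, ∑ j : Fin 3, c i * c j * (α k * (((i : ℝ) + j - 1) * r) ^ k)
        = α k * q * r ^ k := by
      rw [hq, Finset.mul_sum, Finset.sum_mul]
      refine Finset.sum_congr rfl fun i _ => ?_
      rw [Finset.mul_sum, Finset.sum_mul]
      refine Finset.sum_congr rfl fun j _ => ?_
      rw [mul_pow]; ring
    simp only [mul_sub, Finset.sum_sub_distrib, h0, h1, sub_zero]
  -- Half the size of the leading coefficient, so the error cannot change its sign.
  have hev := (hsum.def (c := -(α k * q) / 2) (by nlinarith [mul_pos hαk (neg_pos.2 hq0)]))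
  filter_upwards [hev.filter_mono nhdsWithin_le_nhds, self_mem_nhdsWithin] with r hr hr0
  rw [hid, Real.norm_eq_abs, Real.norm_of_nonneg (pow_pos hr0 k).le] at hr
  have h1 := (le_abs_self _).trans hr
  have h2 : α k * q * r ^ k < 0 := by
    have := mul_pos (mul_pos hαk (neg_pos.2 hq0)) (pow_pos hr0 k)
    nlinarith
  linarith

/-! ### The weighted measure under translation -/

theorem continuous_radialDensity {κ : ℕ} {ψ : ℝ → ℝ} (hcont : Continuous ψ)
    (hpos : ∀ x, 0 < ψ x) : Continuous (radialDensity κ ψ) :=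
  (hcont.comp continuous_norm).inv₀ fun _ => (hpos _).ne'

theorem map_add_right_densityMeasure_le {κ : ℕ} {ρ : EuclideanSpace ℝ (Fin κ) → ℝ}
    (a : EuclideanSpace ℝ (Fin κ)) {c : ℝ} (hc : 0 ≤ c)
    (h : ∀ x, ρ x ≤ c * ρ (x + a)) :
    (densityMeasure κ ρ).map (fun x => x + a) ≤ ENNReal.ofReal c • densityMeasure κ ρ := by
  have hT : Measurable fun x : EuclideanSpace ℝ (Fin κ) => x + a := measurable_add_const a
  refine Measure.le_iff.2 fun s hs => ?_
  rw [Measure.map_apply hT hs, Measure.smul_apply, densityMeasure, withDensity_apply _ (hT hs),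
    withDensity_apply _ hs, smul_eq_mul, ← lintegral_indicator (hT hs), ← lintegral_indicator hs,
    ← lintegral_add_right_eq_self (fun x => s.indicator (fun x => ENNReal.ofReal (ρ x)) x) a,
    ← lintegral_const_mul' _ _ ENNReal.ofReal_ne_top]
  refine lintegral_mono fun x => ?_
  by_cases hx : x + a ∈ s
  · rw [Set.indicator_of_mem hx, Set.indicator_of_mem (show x ∈ (fun x => x + a) ⁻¹' s from hx),
      ← ENNReal.ofReal_mul hc]
    exact ENNReal.ofReal_le_ofReal (h x)
  · rw [Set.indicator_of_notMem (by simpa using hx)]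
    exact zero_le

theorem integral_densityMeasure {κ : ℕ} {ρ : EuclideanSpace ℝ (Fin κ) → ℝ} (hρ : Measurable ρ)
    (hρ0 : ∀ x, 0 ≤ ρ x) (g : EuclideanSpace ℝ (Fin κ) → ℂ) :
    ∫ x, g x ∂densityMeasure κ ρ = ∫ x, ρ x • g x := by
  rw [densityMeasure, integral_withDensity_eq_integral_toReal_smul hρ.ennreal_ofReal
    (Eventually.of_forall fun _ => ENNReal.ofReal_lt_top)]
  simp only [ENNReal.toReal_ofReal (hρ0 _)]

/-! ### Ball functionals and the adjoint -/

/-- The function `1_B ψ(‖·‖)` with `B` the ball with centre `p` and radius `δ`: the Riesz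
representative in `L²(μ_ρ)` of integration over `B` with respect to the Lebesgue measure. -/
noncomputable def ballWeight (κ : ℕ) (ψ : ℝ → ℝ) (p : EuclideanSpace ℝ (Fin κ)) (δ : ℝ) :
    EuclideanSpace ℝ (Fin κ) → ℂ :=
  (Metric.ball p δ).indicator fun x => (ψ ‖x‖ : ℂ)

section

variable {κ : ℕ} {ψ : ℝ → ℝ}

theorem memLp_ballWeight (hcont : Continuous ψ) (hpos : ∀ x, 0 < ψ x)
    (p : EuclideanSpace ℝ (Fin κ)) (δ : ℝ) :
    MemLp (ballWeight κ ψ p δ) 2 (densityMeasure κ (radialDensity κ ψ)) := by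
  have : IsLocallyFiniteMeasure (densityMeasure κ (radialDensity κ ψ)) :=
    IsLocallyFiniteMeasure.withDensity_ofReal (continuous_radialDensity hcont hpos)
  have : IsFiniteMeasure ((densityMeasure κ (radialDensity κ ψ)).restrict (Metric.ball p δ)) :=
    isFiniteMeasure_restrict.2 Metric.isBounded_ball.measure_lt_top.ne
  have hc : Continuous fun x : EuclideanSpace ℝ (Fin κ) => (ψ ‖x‖ : ℂ) :=
    Complex.continuous_ofReal.comp (hcont.comp continuous_norm)
  rw [ballWeight, memLp_indicator_iff_restrict Metric.isOpen_ball.measurableSet]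
  obtain ⟨B, hB⟩ := (isCompact_closedBall p δ).exists_bound_of_continuousOn hc.continuousOn
  exact MemLp.of_bound hc.aestronglyMeasurable B
    ((ae_restrict_mem Metric.isOpen_ball.measurableSet).mono fun x hx =>
      hB x (Metric.ball_subset_closedBall hx))

theorem inner_ballWeight (hcont : Continuous ψ) (hpos : ∀ x, 0 < ψ x)
    (p : EuclideanSpace ℝ (Fin κ)) (δ : ℝ)
    (f : Lp ℂ 2 (densityMeasure κ (radialDensity κ ψ))) :
    ⟪(memLp_ballWeight hcont hpos p δ).toLp _, f⟫_ℂ = ∫ x in Metric.ball p δ, f x := by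
  have hρ := continuous_radialDensity (κ := κ) hcont hpos
  rw [L2.inner_def]
  have h1 : (fun x => ⟪((memLp_ballWeight hcont hpos p δ).toLp _ :
        Lp ℂ 2 (densityMeasure κ (radialDensity κ ψ))) x, f x⟫_ℂ)
      =ᵐ[densityMeasure κ (radialDensity κ ψ)] fun x => ⟪ballWeight κ ψ p δ x, f x⟫_ℂ := by
    filter_upwards [(memLp_ballWeight hcont hpos p δ).coeFn_toLp] with x hx
    rw [hx]
  rw [integral_congr_ae h1, integral_densityMeasure
    hρ.measurable fun x => inv_nonneg.2 (hpos _).le, ← integral_indicator Metric.isOpen_ball.measurableSet]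
  refine integral_congr_ae (Eventually.of_forall fun x => ?_)
  have hx0 : (ψ ‖x‖ : ℂ) ≠ 0 := Complex.ofReal_ne_zero.2 (hpos _).ne'
  by_cases hx : x ∈ Metric.ball p δ
  · simp only [ballWeight, Set.indicator_of_mem hx, radialDensity,
      RCLike.inner_apply, Complex.conj_ofReal, Complex.real_smul, Complex.ofReal_inv]
    field_simp
  · simp only [ballWeight, Set.indicator_of_notMem hx, inner_zero_left, smul_zero]

theorem volume_absolutelyContinuous_densityMeasure (hcont : Continuous ψ) (hpos : ∀ x, 0 < ψ x) :
    volume ≪ densityMeasure κ (radialDensity κ ψ) :=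
  withDensity_absolutelyContinuous'
    (continuous_radialDensity hcont hpos).measurable.ennreal_ofReal.aemeasurable
    (Eventually.of_forall fun x => (ENNReal.ofReal_pos.2 (inv_pos.2 (hpos ‖x‖))).ne')

theorem setIntegral_ball_add_right {E : Type*} [NormedAddCommGroup E] [NormedSpace ℝ E]
    (f : EuclideanSpace ℝ (Fin κ) → E) (p a : EuclideanSpace ℝ (Fin κ)) (δ : ℝ) :
    ∫ x in Metric.ball p δ, f (x + a) = ∫ x in Metric.ball (p + a) δ, f x := by
  have h := (measurePreserving_add_right (volume : Measure (EuclideanSpace ℝ (Fin κ)))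
    a).setIntegral_preimage_emb (measurableEmbedding_addRight a) f (Metric.ball (p + a) δ)
  rw [← h]
  congr 2
  ext x
  simp

theorem norm_sq_ballWeight (hcont : Continuous ψ) (hpos : ∀ x, 0 < ψ x)
    (p : EuclideanSpace ℝ (Fin κ)) (δ : ℝ) :
    ‖(memLp_ballWeight hcont hpos p δ).toLp _‖ ^ 2 = ∫ x in Metric.ball 0 δ, ψ ‖x + p‖ := by
  have h1 := inner_ballWeight hcont hpos p δ ((memLp_ballWeight hcont hpos p δ).toLp _)
  have h2 : ∀ᵐ x ∂(volume : Measure (EuclideanSpace ℝ (Fin κ))), x ∈ Metric.ball p δ →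
      ((memLp_ballWeight hcont hpos p δ).toLp _ :
        Lp ℂ 2 (densityMeasure κ (radialDensity κ ψ))) x = (ψ ‖x‖ : ℂ) := by
    filter_upwards [(volume_absolutelyContinuous_densityMeasure hcont hpos).ae_le
      (memLp_ballWeight hcont hpos p δ).coeFn_toLp] with x hx hxp
    rw [hx, ballWeight, Set.indicator_of_mem hxp]
  rw [setIntegral_congr_ae Metric.isOpen_ball.measurableSet h2, integral_complex_ofReal,
    inner_self_eq_norm_sq_to_K] at h1
  have h3 := setIntegral_ball_add_right (fun x => ψ ‖x‖) 0 p δ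
  rw [zero_add] at h3
  rw [h3]
  exact Complex.ofReal_injective (by simpa using h1)

/-- Pairing with `f` turns the claim into translation invariance: integrating `f (x + a)` over a
ball is integrating `f` over its translate. -/
theorem adjoint_apply_ballWeight (hcont : Continuous ψ) (hpos : ∀ x, 0 < ψ x)
    {a : EuclideanSpace ℝ (Fin κ)}
    {C : Lp ℂ 2 (densityMeasure κ (radialDensity κ ψ)) →L[ℂ]
      Lp ℂ 2 (densityMeasure κ (radialDensity κ ψ))}
    (hC : IsCompositionOperator (densityMeasure κ (radialDensity κ ψ)) (fun x => x + a) C)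
    (p : EuclideanSpace ℝ (Fin κ)) (δ : ℝ) :
    C.adjoint ((memLp_ballWeight hcont hpos p δ).toLp _)
      = (memLp_ballWeight hcont hpos (p + a) δ).toLp _ := by
  refine ext_inner_right ℂ fun f => ?_
  rw [ContinuousLinearMap.adjoint_inner_left, inner_ballWeight hcont hpos,
    inner_ballWeight hcont hpos,
    ← setIntegral_ball_add_right]
  have h := hC f (Lp.memLp f)
  rw [Lp.toLp_coeFn] at h
  exact integral_congr_ae (ae_restrict_of_ae
    ((volume_absolutelyContinuous_densityMeasure hcont hpos).ae_le h))

theorem adjoint_pow_apply_ballWeight (hcont : Continuous ψ) (hpos : ∀ x, 0 < ψ x)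
    {a : EuclideanSpace ℝ (Fin κ)}
    {C : Lp ℂ 2 (densityMeasure κ (radialDensity κ ψ)) →L[ℂ]
      Lp ℂ 2 (densityMeasure κ (radialDensity κ ψ))}
    (hC : IsCompositionOperator (densityMeasure κ (radialDensity κ ψ)) (fun x => x + a) C)
    (p : EuclideanSpace ℝ (Fin κ)) (δ : ℝ) (n : ℕ) :
    (C.adjoint ^ n) ((memLp_ballWeight hcont hpos p δ).toLp _)
      = (memLp_ballWeight hcont hpos (p + n • a) δ).toLp _ := by
  induction n with
  | zero => simp
  | succ n ih =>
    rw [pow_succ', mul_apply_eq_comp, ih, adjoint_apply_ballWeight hcont hpos hC]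
    simp only [succ_nsmul, add_assoc]

end

/-! ### Failure of cosubnormality -/

theorem not_isCosubnormalOperator_of_hankel_neg {κ : ℕ} {ψ : ℝ → ℝ} (hcont : Continuous ψ)
    (hpos : ∀ x, 0 < ψ x) {a : EuclideanSpace ℝ (Fin κ)}
    {C : Lp ℂ 2 (densityMeasure κ (radialDensity κ ψ)) →L[ℂ]
      Lp ℂ 2 (densityMeasure κ (radialDensity κ ψ))}
    (hC : IsCompositionOperator (densityMeasure κ (radialDensity κ ψ)) (fun x => x + a) C)
    (p : EuclideanSpace ℝ (Fin κ)) {n : ℕ} (c : Fin n → ℝ)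
    (hneg : ∑ i, ∑ j, c i * c j * ψ ‖p + (i + j : ℕ) • a‖ < 0) :
    ¬ IsCosubnormalOperator C := by
  intro hS
  have hterm : ∀ i j : Fin n, Continuous fun x : EuclideanSpace ℝ (Fin κ) =>
      c i * c j * ψ ‖x + (p + (i + j : ℕ) • a)‖ := fun i j =>
    continuous_const.mul (hcont.comp (continuous_norm.comp (continuous_add_const _)))
  set Q : EuclideanSpace ℝ (Fin κ) → ℝ := fun x =>
    ∑ i, ∑ j, c i * c j * ψ ‖x + (p + (i + j : ℕ) • a)‖ with hQ
  have hQc : Continuous Q := continuous_finsetSum _ fun i _ => continuous_finsetSum _ fun j _ =>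
    hterm i j
  have hQ0 : Q 0 < 0 := by simpa only [hQ, zero_add] using hneg
  -- By continuity the pointwise form stays negative on a whole ball, so its integral, the Hankel
  -- form of the moments, is negative too.
  obtain ⟨δ, hδ, hball⟩ := Metric.eventually_nhds_iff_ball.1
    (hQc.continuousAt.eventually_lt (continuousAt_const (y := (0 : ℝ))) hQ0)
  have hint : ∀ g : EuclideanSpace ℝ (Fin κ) → ℝ, Continuous g →
      IntegrableOn g (Metric.ball 0 δ) := fun g hg =>
    (hg.continuousOn.integrableOn_compact (isCompact_closedBall 0 δ)).mono_set
      Metric.ball_subset_closedBall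
  have h1 := IsSubnormalOperator.hankel_nonneg hS
    ((memLp_ballWeight hcont hpos p δ).toLp _) c
  simp only [adjoint_pow_apply_ballWeight hcont hpos hC, norm_sq_ballWeight hcont hpos] at h1
  have h2 : ∫ x in Metric.ball 0 δ, Q x = ∑ i, ∑ j, c i * c j *
      ∫ x in Metric.ball (0 : EuclideanSpace ℝ (Fin κ)) δ, ψ ‖x + (p + (i + j : ℕ) • a)‖ := by
    rw [integral_finsetSum _ fun i _ => hint _ (continuous_finsetSum _ fun j _ => hterm i j)]
    refine Finset.sum_congr rfl fun i _ => ?_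
    rw [integral_finsetSum _ fun j _ => hint _ (hterm i j)]
    exact Finset.sum_congr rfl fun j _ => integral_const_mul _ _
  have h3 : 0 < ∫ x in Metric.ball 0 δ, -Q x := by
    rw [setIntegral_pos_iff_support_of_nonneg_ae
      ((ae_restrict_mem Metric.isOpen_ball.measurableSet).mono fun x hx =>
        neg_nonneg.2 (hball x hx).le) (hint _ hQc.neg)]
    refine (Metric.measure_ball_pos volume 0 hδ).trans_le (measure_mono fun x hx => ⟨?_, hx⟩)
    exact neg_ne_zero.2 (hball x hx).ne
  rw [integral_neg, h2] at h3
  linarith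

theorem theorem3p3p2 (κ : ℕ) (hκ : 1 ≤ κ) (k : ℕ) (hk : 4 ≤ k) (hk_even : Even k)
    (ψ : ℝ → ℝ) (hψ_cont : Continuous ψ) (hψ_even : ∀ x, ψ (-x) = ψ x)
    (hψ_pos : ∀ x, 0 < ψ x) (hψ_mem : MemEntireClass k ψ)
    (hψ_lim : limsup (fun x : ℝ => ((deriv ψ x / ψ x : ℝ) : EReal)) atTop < ⊤) :
    ∃ C : EuclideanSpace ℝ (Fin κ) →
        (Lp ℂ 2 (densityMeasure κ (radialDensity κ ψ)) →L[ℂ]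
          Lp ℂ 2 (densityMeasure κ (radialDensity κ ψ))),
      (∀ a, IsCompositionOperator (densityMeasure κ (radialDensity κ ψ)) (fun x => x + a) (C a)) ∧
      ∃ ε : ℝ, 0 < ε ∧ ∀ a : EuclideanSpace ℝ (Fin κ), 0 < ‖a‖ → ‖a‖ < ε →
        ¬ IsCosubnormalOperator (C a) := by
  obtain ⟨α, hα0, hαk, hαpos, hsum⟩ := exists_hasSum_of_memEntireClass hψ_mem
  have hdiff : Differentiable ℝ ψ := by
    have := (hasFPowerSeriesOnBall_ofScalars_of_hasSum hsum).differentiableOn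
    rwa [Metric.eball_top, differentiableOn_univ] at this
  have hmono := monotoneOn_of_hasSum hα0 hsum
  have hex : ∀ a : EuclideanSpace ℝ (Fin κ), ∃ C, IsCompositionOperator
      (densityMeasure κ (radialDensity κ ψ)) (fun x => x + a) C := by
    intro a
    obtain ⟨c, hc, hca⟩ := exists_shift_bound hψ_cont hψ_pos hdiff hψ_lim (norm_nonneg a)
    refine exists_isCompositionOperator (measurable_add_const a) ENNReal.ofReal_ne_top
      (map_add_right_densityMeasure_le a hc.le fun x => ?_)
    have h1 : ψ ‖x + a‖ ≤ c * ψ ‖x‖ :=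
      (hmono (norm_nonneg _) (Set.mem_Ici.2 (by positivity)) (norm_add_le x a)).trans
        (hca _ (norm_nonneg x))
    rw [radialDensity, radialDensity, ← div_eq_mul_inv, le_div_iff₀ (hψ_pos _), mul_comm,
      ← div_eq_mul_inv, div_le_iff₀ (hψ_pos _)]
    exact h1
  choose C hC using hex
  refine ⟨C, hC, ?_⟩
  obtain ⟨ε, hε, hneg⟩ := mem_nhdsGT_iff_exists_Ioo_subset.1
    (eventually_hankel_neg hk hk_even hαk hαpos hsum)
  -- Starting at `-a` produces the shift by `-1` in the arguments `(i + j - 1) * ‖a‖`; evenness of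
  -- `ψ` removes the absolute value.
  refine ⟨ε, hε, fun a ha0 haε => not_isCosubnormalOperator_of_hankel_neg hψ_cont hψ_pos (hC a)
    (-a) (hankelTestVector k) ?_⟩
  have habs : ∀ x, ψ |x| = ψ x := fun x => by
    rcases abs_choice x with h | h <;> rw [h]
    exact hψ_even x
  have hnorm : ∀ m : ℕ, ψ ‖-a + m • a‖ = ψ (((m : ℝ) - 1) * ‖a‖) := by
    intro m
    have : -a + m • a = ((m : ℝ) - 1) • a := by
      rw [sub_smul, one_smul, Nat.cast_smul_eq_nsmul]; abel
    rw [this, norm_smul, Real.norm_eq_abs, ← habs (((m : ℝ) - 1) * ‖a‖), abs_mul, abs_norm]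
  simp only [hnorm, Nat.cast_add]
  exact hneg ⟨ha0, haε⟩
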